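/- Let $E_\rho$ be a universally complete Archimedean real vector lattice (Dedekind complete, and every nonempty set of pairwise disjoint positive elements has a supremum), equipped with a $\Phi$-algebra multiplication, i.e. an $f$-algebra multiplication with identity $e$. Let $E=E_\rho\oplus iE_\rho$ be the associated universally complete Archimedean complex vector lattice, with modulus $|f+ig|=\sup\{(\cos\theta)f+(\sin\theta)g:\theta\in[0,2\pi]\}$ and the canonically extended multiplication $(f+ig)(h+ik)=(fh-gk)+i(fk+gh)$. A sequence $(x_n)_{n\ge 0}$ in $E$ converges in order to $x\in E$ if there is a decreasing sequence $(p_n)_{n\ge 0}$ in $E_\rho$ with $\inf_n p_n=0$ and $|x_n-x|\le p_n$ for all $n$; a series converges in order if its sequence of partial sums does, its sum being the order limit, and $\sum_{n=0}^\infty a_n$ converges absolutely in order if $\sum_{n=0}^\infty|a_n|$ converges in order. A weak order unit is an element $u\ge 0$ of $E_\rho$ such that $u\wedge|x|=0$ implies $x=0$ for all $x\in E_\rho$, and for $x,y\in E_\rho$ we write $x\ll y$ if $(y-x)^+$ is a weak order unit. Let $a\in E$, and put $a^0=e$. Then the geometric series $\sum_{n=0}^{\infty}a^n$ converges absolutely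 in order if and only if $|a|\ll e$. In this case $e-a$ is invertible in $E$, the series $\sum_{n=0}^\infty a^n$ converges in order, and its unique sum is $(e-a)^{-1}$. -/

import Mathlib

/-! ### Real vector lattices

A Dedekind complete real vector lattice is given by Mathlib's mixins
`[ConditionallyCompleteLattice E] [AddCommGroup E] [Module ℝ E] [IsOrderedAddMonoid E]
[IsOrderedModule ℝ E]`: an ordered real vector space that is a lattice in which every nonempty
set that is bounded above (below) has a supremum (infimum). -/

/-- Lateral completeness: every nonempty set of pairwise disjoint positive elements has a
supremum.  (The empty set is left out, as it has a supremum only in the zero space.) -/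
class IsLaterallyComplete (E : Type*) [Lattice E] [AddCommGroup E] : Prop where
  exists_isLUB : ∀ s : Set E, s.Nonempty → (∀ x ∈ s, 0 ≤ x) →
    s.Pairwise (fun x y => x ⊓ y = 0) → ∃ u, IsLUB s u

/-- A universally complete vector lattice is one that is Dedekind complete (the instance
`ConditionallyCompleteLattice`) and laterally complete. -/
class IsUniversallyComplete (E : Type*) [ConditionallyCompleteLattice E] [AddCommGroup E] : Prop
    extends IsLaterallyComplete E

/-- A Dedekind complete vector lattice is Archimedean, so that this need not be assumed. -/
theorem vectorLattice_archimedean {E : Type*} [ConditionallyCompleteLattice E] [AddCommGroup E]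
    [IsOrderedAddMonoid E] (x y : E) (h : ∀ n : ℕ, n • x ≤ y) : x ≤ 0 := by
  have hb : BddAbove (Set.range fun n : ℕ => n • x) := ⟨y, by rintro _ ⟨n, rfl⟩; exact h n⟩
  have h1 : (⨆ n : ℕ, n • x) ≤ (⨆ n : ℕ, n • x) - x := by
    refine ciSup_le fun n => ?_
    have := le_ciSup hb (n + 1)
    rw [le_sub_iff_add_le, ← succ_nsmul]
    exact this
  simpa using h1

/-- The laws of a real `Φ`-algebra: the multiplication of a (unital, associative) real algebra
that is also a vector lattice makes it an `f`-algebra. -/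
class IsPhiAlgebra (A : Type*) [Lattice A] [Ring A] [Algebra ℝ A] : Prop where
  mul_nonneg : ∀ a b : A, 0 ≤ a → 0 ≤ b → 0 ≤ a * b
  mul_left_inf : ∀ a b c : A, a ⊓ b = 0 → 0 ≤ c → (c * a) ⊓ b = 0
  mul_right_inf : ∀ a b c : A, a ⊓ b = 0 → 0 ≤ c → (a * c) ⊓ b = 0

/-- A weak order unit: a positive element which is disjoint only from `0`. -/
def IsWeakOrderUnit {E : Type*} [Lattice E] [AddCommGroup E] (u : E) : Prop :=
  0 ≤ u ∧ ∀ x : E, u ⊓ |x| = 0 → x = 0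

/-- The relation `x ≪ y`: the positive part of `y - x` is a weak order unit. -/
def StrictlyBelow {E : Type*} [Lattice E] [AddCommGroup E] (x y : E) : Prop :=
  IsWeakOrderUnit (y - x)⁺

/-! ### The complexification -/

/-- The complexification `E ⊕ iE`; the pair `⟨f, g⟩` stands for `f + ig`. -/
@[ext]
structure Complexification (E : Type*) where
  re : E
  im : E

namespace Complexification

section Ring

variable {E : Type*} [Ring E]

instance : Zero (Complexification E) := ⟨⟨0, 0⟩⟩
instance : One (Complexification E) := ⟨⟨1, 0⟩⟩
instance : Add (Complexification E) := ⟨fun a b => ⟨a.re + b.re, a.im + b.im⟩⟩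
instance : Neg (Complexification E) := ⟨fun a => ⟨-a.re, -a.im⟩⟩

/-- The canonical extension `(f + ig)(h + ik) = (fh - gk) + i(fk + gh)`. -/
instance : Mul (Complexification E) :=
  ⟨fun a b => ⟨a.re * b.re - a.im * b.im, a.re * b.im + a.im * b.re⟩⟩

@[simp] theorem zero_re : (0 : Complexification E).re = 0 := rfl
@[simp] theorem zero_im : (0 : Complexification E).im = 0 := rfl
@[simp] theorem one_re : (1 : Complexification E).re = 1 := rfl
@[simp] theorem one_im : (1 : Complexification E).im = 0 := rfl
@[simp] theorem add_re (a b : Complexification E) : (a + b).re = a.re + b.re := rfl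
@[simp] theorem add_im (a b : Complexification E) : (a + b).im = a.im + b.im := rfl
@[simp] theorem neg_re (a : Complexification E) : (-a).re = -a.re := rfl
@[simp] theorem neg_im (a : Complexification E) : (-a).im = -a.im := rfl
@[simp] theorem mul_re (a b : Complexification E) :
    (a * b).re = a.re * b.re - a.im * b.im := rfl
@[simp] theorem mul_im (a b : Complexification E) :
    (a * b).im = a.re * b.im + a.im * b.re := rfl

instance : Ring (Complexification E) where
  add_assoc a b c := by ext <;> simp [add_assoc]
  zero_add a := by ext <;> simp
  add_zero a := by ext <;> simp
  add_comm a b := by ext <;> simp [add_comm]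
  neg_add_cancel a := by ext <;> simp
  nsmul := nsmulRec
  zsmul := zsmulRec
  mul_assoc a b c := by ext <;> simp <;> noncomm_ring
  one_mul a := by ext <;> simp
  mul_one a := by ext <;> simp
  left_distrib a b c := by ext <;> simp <;> noncomm_ring
  right_distrib a b c := by ext <;> simp <;> noncomm_ring
  zero_mul a := by ext <;> simp
  mul_zero a := by ext <;> simp

/-- The embedding of the real part `E` into `E ⊕ iE`. -/
def ofReal (f : E) : Complexification E := ⟨f, 0⟩

end Ring

/-- The modulus `|f + ig| = sup {(cos θ) f + (sin θ) g : θ ∈ [0, 2π]}`. -/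
noncomputable def modulus {E : Type*} [ConditionallyCompleteLattice E] [AddCommGroup E]
    [Module ℝ E] (a : Complexification E) : E :=
  sSup ((fun θ : ℝ => Real.cos θ • a.re + Real.sin θ • a.im) '' Set.Icc 0 (2 * Real.pi))

/-- The supremum that defines the modulus exists. -/
theorem isLUB_modulus {E : Type*} [ConditionallyCompleteLattice E] [AddCommGroup E]
    [Module ℝ E] [IsOrderedAddMonoid E] [IsOrderedModule ℝ E] (a : Complexification E) :
    IsLUB ((fun θ : ℝ => Real.cos θ • a.re + Real.sin θ • a.im) '' Set.Icc 0 (2 * Real.pi))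
      (modulus a) := by
  have key : ∀ (c : ℝ) (f : E), |c| ≤ 1 → c • f ≤ |f| := by
    intro c f hc
    obtain ⟨h1, h2⟩ := abs_le.1 hc
    rcases le_total 0 c with h | h
    · calc c • f ≤ c • |f| := smul_le_smul_of_nonneg_left (le_abs_self f) h
        _ ≤ (1 : ℝ) • |f| := smul_le_smul_of_nonneg_right h2 (abs_nonneg f)
        _ = |f| := one_smul _ _
    · calc c • f = (-c) • (-f) := by simp
        _ ≤ (-c) • |f| := smul_le_smul_of_nonneg_left (neg_le_abs f) (by linarith)
        _ ≤ (1 : ℝ) • |f| := smul_le_smul_of_nonneg_right (by linarith) (abs_nonneg f)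
        _ = |f| := one_smul _ _
  refine isLUB_csSup ⟨_, 0, ⟨le_rfl, by positivity⟩, rfl⟩ ⟨|a.re| + |a.im|, ?_⟩
  rintro _ ⟨θ, -, rfl⟩
  exact add_le_add (key _ _ (Real.abs_cos_le_one θ)) (key _ _ (Real.abs_sin_le_one θ))

section Convergence

variable {E : Type*} [ConditionallyCompleteLattice E] [Ring E] [Module ℝ E]

/-- The sequence `x` converges in order to `l`: there is a sequence `p n ↓ 0` in the real part
with `|x n - l| ≤ p n` for all `n`. -/
def OrderConvergesTo (x : ℕ → Complexification E) (l : Complexification E) : Prop :=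
  ∃ p : ℕ → E, Antitone p ∧ IsGLB (Set.range p) 0 ∧ ∀ n, modulus (x n - l) ≤ p n

/-- `s` is the sum of the order convergent series `∑ a n`: the partial sums
`a 0 + ⋯ + a m`, `m = 0, 1, 2, …`, converge in order to `s`. -/
def HasOrderSum (a : ℕ → Complexification E) (s : Complexification E) : Prop :=
  OrderConvergesTo (fun m => ∑ n ∈ Finset.range (m + 1), a n) s

/-- The series `∑ a n` converges absolutely in order: the series `∑ |a n|` converges in order. -/
def AbsConvergesInOrder (a : ℕ → Complexification E) : Prop :=
  ∃ s, HasOrderSum (fun n => ofReal (modulus (a n))) s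

end Convergence

end Complexification

/-! Write r = |a|. If r ≪ e, then d = e - r is a positive weak order unit, and each partial sum s of
∑ rⁿ satisfies s * d = e - rᵐ ≤ e. Universal completeness bounds all such s
(`bddAbove_of_mul_le_one`): cut e into disjoint components on which (k + 1)d ≥ e, so that s ≤ k + 1
there, and glue these bounds by lateral completeness. Dedekind completeness then yields the sums of
∑ |aⁿ| and ∑ aⁿ. Conversely, order convergence forces rᵐ to be dominated by a sequence decreasing to
0, whereas any z ≤ e disjoint from (e - r)⁺ satisfies z ≤ rᵐ z ≤ rᵐ; hence z = 0. The sum is the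
inverse because (e - a) times a partial sum is e minus a power of a.

Passing from aⁿ to rⁿ needs |ab| = |a||b|. This follows from |f + ig|² = f² + g²
(`modulus_mul_self`) and uniqueness of positive square roots. No representation by functions is
used: the identity, like commutativity of the product, comes from a discrete intermediate value
theorem and the Archimedean property, and suprema pass through products by `mul_le_of_isLUB`. -/

set_option linter.unusedSectionVars false

/-! ### Lattice-ordered groups and a discrete intermediate value theorem -/

section LatticeGroup

variable {E : Type*} [Lattice E] [AddCommGroup E] [IsOrderedAddMonoid E]

theorem inf_add_le_inf_add {x y z : E} (hz : 0 ≤ z) : x ⊓ (y + z) ≤ x ⊓ y + z := by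
  rw [← sub_le_iff_le_add]
  exact le_inf ((sub_le_self _ hz).trans inf_le_left) (sub_le_iff_le_add.2 inf_le_right)

theorem eq_zero_of_abs_nonpos {x : E} (h : |x| ≤ 0) : x = 0 :=
  le_antisymm ((le_abs_self x).trans h) (neg_nonpos.1 ((neg_le_abs x).trans h))

theorem abs_sub_eq_add_of_inf_eq_zero {x y : E} (h : x ⊓ y = 0) : |x - y| = x + y := by
  rw [abs_sub_comm, ← sup_sub_inf_eq_abs_sub, h, sub_zero, ← inf_add_sup x y, h, zero_add]

/-- A discrete intermediate value theorem: a finite sequence with small steps that passes from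
positive to negative values comes close to zero. -/
theorem inf_posPart_inf_negPart_le_of_abs_sub_le {y : ℕ → E} {t d : E}
    (ht : ∀ j, t ≤ |y j|) (hd : ∀ j, |y (j + 1) - y j| ≤ d) (n : ℕ) :
    t ⊓ (y 0)⁺ ⊓ (y n)⁻ ≤ d := by
  have hd0 : 0 ≤ d := (abs_nonneg _).trans (hd 0)
  let : DistribLattice E := AddCommGroup.toDistribLattice E
  induction n with
  | zero =>
    refine (inf_le_inf_right _ inf_le_right).trans ?_
    rw [posPart_inf_negPart_eq_zero]; exact hd0
  | succ k ih =>
    -- Split along |y k|: where y k is positive, one step can make y (k + 1) negative by at most d;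
    -- where y k is negative, the induction hypothesis applies.
    have h1 : t ⊓ (y 0)⁺ ⊓ (y (k + 1))⁻ ≤ (y k)⁺ ⊔ (y k)⁻ := by
      refine (inf_le_left.trans inf_le_left).trans ((ht k).trans ?_)
      rw [abs]
      exact sup_le_sup (le_posPart _) (neg_le_negPart _)
    rw [← inf_eq_left.2 h1, inf_sup_left]
    refine sup_le ?_ ?_
    · refine (inf_le_inf_right _ inf_le_right).trans ?_
      have h2 : (y k)⁺ ≤ (y (k + 1))⁺ + d := by
        refine sup_le ?_ (add_nonneg (posPart_nonneg _) hd0)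
        have := (neg_le_abs _).trans (hd k)
        rw [neg_sub, sub_le_iff_le_add'] at this
        exact this.trans (add_le_add_left (le_posPart _) _)
      refine (inf_le_inf_left _ h2).trans ((inf_add_le_inf_add hd0).trans ?_)
      rw [inf_comm, posPart_inf_negPart_eq_zero, zero_add]
    · exact (inf_le_inf_right _ inf_le_left).trans ih

theorem le_of_abs_sub_le_of_nonneg_of_nonpos {y : ℕ → E} {t d : E} {n : ℕ}
    (ht : ∀ j, t ≤ |y j|) (hd : ∀ j, |y (j + 1) - y j| ≤ d) (h0 : 0 ≤ y 0) (hn : y n ≤ 0) :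
    t ≤ d := by
  have := inf_posPart_inf_negPart_le_of_abs_sub_le ht hd n
  rwa [posPart_eq_self.2 h0, negPart_eq_neg.2 hn, ← abs_of_nonneg h0, inf_eq_left.2 (ht 0),
    ← abs_of_nonpos hn, inf_eq_left.2 (ht n)] at this

/-- The intermediate value bound for y controls t on the part where y 0 is positive, and the one for
-y controls it where y 0 is negative; together these parts cover t. -/
theorem le_of_abs_sub_le_of_eq_neg {y : ℕ → E} {t d : E} {n : ℕ}
    (ht : ∀ j, t ≤ |y j|) (hd : ∀ j, |y (j + 1) - y j| ≤ d) (hn : y n = - y 0) :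
    t ≤ d := by
  let : DistribLattice E := AddCommGroup.toDistribLattice E
  have h1 := inf_posPart_inf_negPart_le_of_abs_sub_le ht hd n
  have h2 := inf_posPart_inf_negPart_le_of_abs_sub_le (y := fun j => - y j) (t := t) (d := d)
    (fun j => by simpa using ht j) (fun j => by
      have := hd j
      rw [abs_sub_comm] at this
      rwa [show - y (j + 1) - - y j = y j - y (j + 1) by abel]) n
  simp only [hn, negPart_neg, posPart_neg, neg_neg] at h1 h2
  rw [inf_assoc, inf_idem] at h1 h2
  have h3 : t ≤ (y 0)⁺ ⊔ (y 0)⁻ := by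
    refine (ht 0).trans ?_
    rw [abs]
    exact sup_le_sup (le_posPart _) (neg_le_negPart _)
  rw [← inf_eq_left.2 h3, inf_sup_left]
  exact sup_le h1 h2

/-- Otherwise m - w/N would be a better upper bound. This replaces the choice of an x close to the
supremum. -/
theorem le_of_isLUB_of_forall_le_nsmul_sub [Module ℝ E] [IsOrderedModule ℝ E] {s : Set E} {m w : E}
    (hm : IsLUB s m) {N : ℕ} (hN : 0 < N) (h : ∀ x ∈ s, w ≤ N • (m - x)) : w ≤ 0 := by
  have hN' : (0 : ℝ) < N := by exact_mod_cast hN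
  have h1 : m ≤ m - (N : ℝ)⁻¹ • w := by
    refine hm.2 fun x hx => ?_
    have h2 := smul_le_smul_of_nonneg_left (h x hx) (inv_nonneg.2 hN'.le)
    rw [← Nat.cast_smul_eq_nsmul ℝ, inv_smul_smul₀ hN'.ne'] at h2
    rw [le_sub_iff_add_le, add_comm, ← le_sub_iff_add_le]
    exact h2
  have h3 : (N : ℝ)⁻¹ • w ≤ 0 := by
    rw [le_sub_iff_add_le] at h1
    simpa using h1
  have := smul_le_smul_of_nonneg_left h3 hN'.le
  rwa [smul_inv_smul₀ hN'.ne', smul_zero] at this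

theorem nonneg_of_nsmul_nonneg [Module ℝ E] [IsOrderedModule ℝ E] {x : E} {n : ℕ} (hn : 0 < n)
    (h : 0 ≤ n • x) : 0 ≤ x := by
  have hN' : (0 : ℝ) < n := by exact_mod_cast hn
  have := smul_le_smul_of_nonneg_left h (inv_nonneg.2 hN'.le)
  rwa [← Nat.cast_smul_eq_nsmul ℝ, inv_smul_smul₀ hN'.ne', smul_zero] at this

end LatticeGroup

/-! ### Elementary arithmetic of Φ-algebras -/

namespace IsPhiAlgebra

section Lattice

variable {E : Type*} [Lattice E] [Ring E] [Algebra ℝ E] [IsOrderedAddMonoid E] [IsPhiAlgebra E]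

theorem mul_le_mul_left_of_nonneg {x y c : E} (h : x ≤ y) (hc : 0 ≤ c) : c * x ≤ c * y := by
  rw [← sub_nonneg, ← mul_sub]
  exact mul_nonneg _ _ hc (sub_nonneg.2 h)

theorem mul_le_mul_right_of_nonneg {x y c : E} (h : x ≤ y) (hc : 0 ≤ c) : x * c ≤ y * c := by
  rw [← sub_nonneg, ← sub_mul]
  exact mul_nonneg _ _ (sub_nonneg.2 h) hc

theorem mul_eq_zero_of_inf_eq_zero {x y : E} (h : x ⊓ y = 0) : x * y = 0 := by
  have hx : 0 ≤ x := h ▸ inf_le_left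
  have hy : 0 ≤ y := h ▸ inf_le_right
  have h1 := mul_right_inf x y y h hy
  rw [inf_comm] at h1
  simpa using mul_left_inf y (x * y) x h1 hx

theorem posPart_mul_negPart (x : E) : x⁺ * x⁻ = 0 :=
  mul_eq_zero_of_inf_eq_zero (posPart_inf_negPart_eq_zero x)

theorem negPart_mul_posPart (x : E) : x⁻ * x⁺ = 0 :=
  mul_eq_zero_of_inf_eq_zero (inf_comm x⁺ x⁻ ▸ posPart_inf_negPart_eq_zero x)

variable (E) in
theorem one_nonneg : (0 : E) ≤ 1 := by
  -- Multiplying 1⁺ by 1⁻ keeps it disjoint from 1⁻, yet the product is 1⁻ + 1⁻ * 1⁻ ≥ 1⁻; so 1⁻ =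
  -- 0.
  have h1 := mul_left_inf (1 : E)⁺ 1⁻ 1⁻ (posPart_inf_negPart_eq_zero _) (negPart_nonneg _)
  have h2 : (1 : E)⁻ * 1⁺ = 1⁻ + 1⁻ * 1⁻ := by
    have : (1 : E)⁺ = 1 + 1⁻ := by
      nth_rewrite 2 [← posPart_sub_negPart (1 : E)]
      abel
    rw [this, mul_add, mul_one]
  rw [h2, inf_eq_right.2 (le_add_of_nonneg_right
    (mul_nonneg _ _ (negPart_nonneg _) (negPart_nonneg _)))] at h1
  exact negPart_eq_zero.1 h1

theorem mul_self_eq (x : E) : x * x = x⁺ * x⁺ + x⁻ * x⁻ := by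
  nth_rewrite 1 2 [← posPart_sub_negPart x]
  rw [sub_mul, mul_sub, mul_sub, posPart_mul_negPart, negPart_mul_posPart]
  abel

theorem mul_self_nonneg (x : E) : 0 ≤ x * x := by
  rw [mul_self_eq]
  exact add_nonneg (mul_nonneg _ _ (posPart_nonneg _) (posPart_nonneg _))
    (mul_nonneg _ _ (negPart_nonneg _) (negPart_nonneg _))

theorem posPart_mul_posPart_le (x : E) : x⁺ * x⁺ ≤ x * x := by
  rw [mul_self_eq x, ← sub_nonneg, add_sub_cancel_left]
  exact mul_nonneg _ _ (negPart_nonneg _) (negPart_nonneg _)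

theorem abs_mul_abs_self (x : E) : |x| * |x| = x * x := by
  rw [mul_self_eq x, ← posPart_add_negPart, add_mul, mul_add, mul_add, posPart_mul_negPart,
    negPart_mul_posPart]
  abel

theorem abs_mul_of_nonneg_right (x : E) {c : E} (hc : 0 ≤ c) : |x * c| = |x| * c := by
  have h : (x⁺ * c) ⊓ (x⁻ * c) = 0 := by
    have h1 := mul_right_inf _ _ c (posPart_inf_negPart_eq_zero x) hc
    rw [inf_comm] at h1 ⊢
    exact mul_right_inf _ _ c h1 hc
  nth_rewrite 1 [← posPart_sub_negPart x]
  rw [sub_mul, abs_sub_eq_add_of_inf_eq_zero h, ← posPart_add_negPart, add_mul]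

theorem abs_mul_of_nonneg_left (x : E) {c : E} (hc : 0 ≤ c) : |c * x| = c * |x| := by
  have h : (c * x⁺) ⊓ (c * x⁻) = 0 := by
    have h1 := mul_left_inf _ _ c (posPart_inf_negPart_eq_zero x) hc
    rw [inf_comm] at h1 ⊢
    exact mul_left_inf _ _ c h1 hc
  nth_rewrite 1 [← posPart_sub_negPart x]
  rw [mul_sub, abs_sub_eq_add_of_inf_eq_zero h, ← posPart_add_negPart, mul_add]

theorem pow_nonneg {x : E} (hx : 0 ≤ x) (n : ℕ) : 0 ≤ x ^ n := by
  induction n with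
  | zero => rw [pow_zero]; exact one_nonneg E
  | succ n ih => rw [pow_succ]; exact mul_nonneg _ _ ih hx

theorem natCast_nonneg (n : ℕ) : (0 : E) ≤ n := by
  rw [← nsmul_one]
  exact nsmul_nonneg (one_nonneg E) n

/-- With u = (c - n)⁺ one has u(c - n) = u² ≥ 0, so nu ≤ uc ≤ c². Thus the error of truncating c at
n is at most c²/n. -/
theorem nsmul_posPart_sub_natCast_le {c : E} (hc : 0 ≤ c) (n : ℕ) :
    n • (c - n)⁺ ≤ c * c := by
  have h1 : (c - n)⁺ * n ≤ (c - n)⁺ * c := by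
    rw [← sub_nonneg, ← mul_sub]
    nth_rewrite 2 [← posPart_sub_negPart (c - (n : E))]
    rw [mul_sub, posPart_mul_negPart, sub_zero]
    exact mul_self_nonneg _
  have h2 : (c - n)⁺ ≤ c := sup_le (sub_le_self _ (natCast_nonneg n)) hc
  rw [nsmul_eq_mul, Nat.cast_comm]
  exact h1.trans (mul_le_mul_right_of_nonneg h2 hc)

end Lattice

/-! ### Commutativity and order continuity of multiplication -/

section Complete

variable {E : Type*} [ConditionallyCompleteLattice E] [Ring E] [Algebra ℝ E]
  [IsOrderedAddMonoid E] [IsOrderedModule ℝ E] [IsPhiAlgebra E]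

theorem commute_of_nonneg_of_le_natCast {c x : E} {k : ℕ} (hc : 0 ≤ c) (hck : c ≤ k)
    (hx : 0 ≤ x) (hxk : x ≤ k) : Commute c x := by
  have key : |c * x - x * c| ≤ 0 := by
    refine vectorLattice_archimedean _ ((2 * k) • (1 : E)) fun n => ?_
    -- For every j, n(cx - xc) is the commutator of c with n x - j, hence bounded by 2k|n x - j|. As
    -- j runs from 0 to nk this passes from positive to negative in steps of 2k, so n|cx - xc| ≤ 2k.
    refine le_of_abs_sub_le_of_nonneg_of_nonpos (n := n * k)
      (y := fun j => (2 * k) • (n • x - j • (1 : E))) (fun j => ?_) (fun j => ?_) ?_ ?_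
    · have h1 : n • (c * x - x * c) = c * (n • x - j • (1 : E)) - (n • x - j • (1 : E)) * c := by
        simp only [nsmul_eq_mul, mul_sub, sub_mul, ← mul_assoc, mul_one]
        rw [Nat.cast_comm j, Nat.cast_comm n c]
        abel
      have h2 : |n • (c * x - x * c)| = n • |c * x - x * c| := by
        simp only [nsmul_eq_mul]
        exact abs_mul_of_nonneg_left _ (natCast_nonneg n)
      have h3 : ∀ z : E, |(2 * k) • z| = k * |z| + |z| * k := by
        intro z
        rw [nsmul_eq_mul, abs_mul_of_nonneg_left _ (natCast_nonneg _), ← Nat.cast_comm]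
        push_cast
        noncomm_ring
      rw [← h2, h1, h3, sub_eq_add_neg]
      refine (abs_add_le _ _).trans ?_
      rw [abs_neg, abs_mul_of_nonneg_left _ hc, abs_mul_of_nonneg_right _ hc]
      exact add_le_add (mul_le_mul_right_of_nonneg hck (abs_nonneg _))
        (mul_le_mul_left_of_nonneg hck (abs_nonneg _))
    · refine le_of_eq ?_
      rw [← nsmul_sub, show n • x - (j + 1) • (1 : E) - (n • x - j • (1 : E)) = -1 by
        rw [succ_nsmul]; abel, smul_neg, abs_neg,
        abs_of_nonneg (nsmul_nonneg (one_nonneg E) _)]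
    · rw [zero_smul, sub_zero]
      exact nsmul_nonneg (nsmul_nonneg hx _) _
    · refine nsmul_nonpos (sub_nonpos.2 ?_) _
      rw [mul_nsmul', nsmul_one k]
      exact nsmul_le_nsmul_right hxk n
  exact sub_eq_zero.1 (eq_zero_of_abs_nonpos key)

/-- Only the truncation error (c - n)⁺ ≤ c²/n contributes to the commutator, and it vanishes as n
grows. -/
theorem commute_of_forall_commute_inf_natCast {c x : E} (hc : 0 ≤ c) (hx : 0 ≤ x)
    (h : ∀ n : ℕ, Commute (c ⊓ n) x) : Commute c x := by
  have key : |c * x - x * c| ≤ 0 := by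
    refine vectorLattice_archimedean _ (c * c * x + x * (c * c)) fun n => ?_
    set u := (c - n)⁺ with hu
    have h1 : c * x - x * c = u * x - x * u := by
      have h2 := (h n).eq
      rw [inf_eq_sub_posPart_sub, ← hu, sub_mul, mul_sub] at h2
      rw [sub_eq_sub_iff_add_eq_add] at h2 ⊢
      rw [add_comm (u * x)]
      exact h2
    have h3 : |c * x - x * c| ≤ u * x + x * u := by
      rw [h1, sub_eq_add_neg]
      refine (abs_add_le _ _).trans (le_of_eq ?_)
      rw [abs_neg, abs_of_nonneg (mul_nonneg _ _ (posPart_nonneg _) hx),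
        abs_of_nonneg (mul_nonneg _ _ hx (posPart_nonneg _))]
    have h4 : n • u ≤ c * c := nsmul_posPart_sub_natCast_le hc n
    refine (nsmul_le_nsmul_right h3 n).trans ?_
    rw [nsmul_add, ← smul_mul_assoc, ← mul_smul_comm]
    exact add_le_add (mul_le_mul_right_of_nonneg h4 hx) (mul_le_mul_left_of_nonneg h4 hx)
  exact sub_eq_zero.1 (eq_zero_of_abs_nonpos key)

/-- A Dedekind complete `Φ`-algebra is commutative. -/
theorem commute (x y : E) : Commute x y := by
  have h : ∀ c x : E, 0 ≤ c → 0 ≤ x → Commute c x := by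
    intro c x hc hx
    refine commute_of_forall_commute_inf_natCast hc hx fun n => Commute.symm ?_
    refine commute_of_forall_commute_inf_natCast hx (le_inf hc (natCast_nonneg n)) fun m => ?_
    refine commute_of_nonneg_of_le_natCast (k := m + n) (le_inf hx (natCast_nonneg m)) ?_
      (le_inf hc (natCast_nonneg n)) ?_
    · push_cast
      exact inf_le_right.trans (le_add_of_nonneg_right (natCast_nonneg n))
    · push_cast
      exact inf_le_right.trans (le_add_of_nonneg_left (natCast_nonneg m))
  rw [← posPart_sub_negPart x, ← posPart_sub_negPart y]
  refine Commute.sub_left (Commute.sub_right ?_ ?_) (Commute.sub_right ?_ ?_) <;>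
    exact h _ _ (posPart_nonneg _) (posPart_nonneg _)

/-- Multiplication by a positive element is order continuous. -/
theorem mul_le_of_isLUB {s : Set E} {m c z : E} (hm : IsLUB s m) (hs : ∀ x ∈ s, 0 ≤ x)
    (hc : 0 ≤ c) (h : ∀ x ∈ s, c * x ≤ z) : c * m ≤ z := by
  refine sub_nonpos.1 (vectorLattice_archimedean _ (c * c * m) fun n => ?_)
  rcases Nat.eq_zero_or_pos n with rfl | hn
  · rcases s.eq_empty_or_nonempty with rfl | ⟨x, hx⟩
    -- The supremum of the empty set is a least element, which can only be 0.
    · have : m = 0 := by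
        have h1 : ∀ y : E, m ≤ y := fun y => hm.2 (by simp)
        have h2 := h1 (m + m)
        exact le_antisymm (h1 0) (by simpa using h2)
      simp [this]
    · rw [zero_smul]
      exact mul_nonneg _ _ (mul_self_nonneg c) ((hs x hx).trans (hm.1 hx))
  · refine sub_nonpos.1 (le_of_isLUB_of_forall_le_nsmul_sub hm (N := n * n) (by positivity)
      fun x hx => ?_)
    have hmx : 0 ≤ m - x := sub_nonneg.2 (hm.1 hx)
    have h1 : n • (c * m - z) ≤ n • (c * (m - x)) := by
      refine nsmul_le_nsmul_right ?_ n
      rw [mul_sub]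
      exact sub_le_sub_left (h x hx) _
    -- From (c - n)² ≥ 0 comes 2nc ≤ n² + c²: the unbounded factor c is traded for the scalar n²,
    -- which the supremum absorbs, and c², which does not depend on n.
    have h2 : n • (c * (m - x)) ≤ (n * n) • (m - x) + c * c * (m - x) := by
      have h3 : 0 ≤ (c - n) * (c - n) * (m - x) + n • (c * (m - x)) + n • (c * (m - x))
          - n • (c * (m - x)) := by
        rw [add_sub_cancel_right]
        exact add_nonneg (mul_nonneg _ _ (mul_self_nonneg _) hmx)
          (nsmul_nonneg (mul_nonneg _ _ hc hmx) n)
      rw [← sub_nonneg]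
      convert h3 using 1
      simp only [nsmul_eq_mul, sub_mul, mul_sub, Nat.cast_mul, mul_assoc, ← Nat.cast_comm]
      simp only [← mul_assoc, Nat.cast_comm n c]
      noncomm_ring
    have h4 : c * c * (m - x) ≤ c * c * m :=
      mul_le_mul_left_of_nonneg (sub_le_self _ (hs x hx)) (mul_self_nonneg c)
    rw [sub_le_iff_le_add]
    exact h1.trans (h2.trans (add_le_add_right h4 _))

end Complete
end IsPhiAlgebra
-- The modulus and the identity |f + ig|² = f² + g²
namespace Complexification

section Modulus

variable {E : Type*} [ConditionallyCompleteLattice E] [AddCommGroup E] [Module ℝ E]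
  [IsOrderedAddMonoid E] [IsOrderedModule ℝ E]

theorem isLUB_range_modulus (a : Complexification E) :
    IsLUB (Set.range fun θ : ℝ => Real.cos θ • a.re + Real.sin θ • a.im) (modulus a) := by
  have hp : Function.Periodic (fun θ : ℝ => Real.cos θ • a.re + Real.sin θ • a.im)
      (2 * Real.pi) := fun θ => by simp
  have h := isLUB_modulus a
  rwa [← zero_add (2 * Real.pi), hp.image_Icc (by positivity)] at h

theorem le_modulus (a : Complexification E) (θ : ℝ) :
    Real.cos θ • a.re + Real.sin θ • a.im ≤ modulus a :=
  (isLUB_range_modulus a).1 ⟨θ, rfl⟩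

theorem modulus_le {a : Complexification E} {z : E}
    (h : ∀ θ : ℝ, Real.cos θ • a.re + Real.sin θ • a.im ≤ z) : modulus a ≤ z :=
  (isLUB_range_modulus a).2 (by rintro _ ⟨θ, rfl⟩; exact h θ)

theorem abs_le_modulus (a : Complexification E) (θ : ℝ) :
    |Real.cos θ • a.re + Real.sin θ • a.im| ≤ modulus a := by
  refine abs_le'.2 ⟨le_modulus a θ, ?_⟩
  have := le_modulus a (θ + Real.pi)
  rw [Real.cos_add_pi, Real.sin_add_pi] at this
  convert this using 1
  module

theorem abs_re_le_modulus (a : Complexification E) : |a.re| ≤ modulus a := by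
  simpa using abs_le_modulus a 0

theorem abs_im_le_modulus (a : Complexification E) : |a.im| ≤ modulus a := by
  simpa using abs_le_modulus a (Real.pi / 2)

theorem modulus_nonneg (a : Complexification E) : 0 ≤ modulus a :=
  (abs_nonneg _).trans (abs_re_le_modulus a)

theorem smul_le_smul_abs {c d : ℝ} (h : |c| ≤ d) (f : E) : c • f ≤ d • |f| := by
  obtain ⟨h1, h2⟩ := abs_le.1 h
  rcases le_total 0 c with h0 | h0
  · exact (smul_le_smul_of_nonneg_left (le_abs_self f) h0).trans
      (smul_le_smul_of_nonneg_right h2 (abs_nonneg f))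
  · calc c • f = (-c) • (-f) := by simp
      _ ≤ (-c) • |f| := smul_le_smul_of_nonneg_left (neg_le_abs f) (by linarith)
      _ ≤ d • |f| := smul_le_smul_of_nonneg_right (by linarith) (abs_nonneg f)

theorem abs_smul_le {c d : ℝ} (h : |c| ≤ d) (f : E) : |c • f| ≤ d • |f| :=
  abs_le'.2 ⟨smul_le_smul_abs h f, by
    rw [← neg_smul]; exact smul_le_smul_abs (by rwa [abs_neg]) f⟩

theorem modulus_le_abs_add_abs (a : Complexification E) : modulus a ≤ |a.re| + |a.im| := by
  refine modulus_le fun θ => add_le_add ?_ ?_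
  · simpa using smul_le_smul_abs (Real.abs_cos_le_one θ) a.re
  · simpa using smul_le_smul_abs (Real.abs_sin_le_one θ) a.im

end Modulus

section Ring

variable {E : Type*} [ConditionallyCompleteLattice E] [Ring E] [Algebra ℝ E]
  [IsOrderedAddMonoid E] [IsOrderedModule ℝ E]

@[simp] theorem sub_re (a b : Complexification E) : (a - b).re = a.re - b.re := by
  rw [sub_eq_add_neg, add_re, neg_re, sub_eq_add_neg]

@[simp] theorem sub_im (a b : Complexification E) : (a - b).im = a.im - b.im := by
  rw [sub_eq_add_neg, add_im, neg_im, sub_eq_add_neg]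

theorem modulus_ofReal (f : E) : modulus (ofReal f) = |f| := by
  refine le_antisymm ?_ (abs_re_le_modulus (ofReal f))
  refine (modulus_le_abs_add_abs _).trans (le_of_eq ?_)
  simp [ofReal]

theorem modulus_add_le (a b : Complexification E) :
    modulus (a + b) ≤ modulus a + modulus b := by
  refine modulus_le fun θ => ?_
  refine le_trans (le_of_eq ?_) (add_le_add (le_modulus a θ) (le_modulus b θ))
  simp only [add_re, add_im]
  module

theorem modulus_neg (a : Complexification E) : modulus (-a) = modulus a := by
  have key : ∀ b : Complexification E, modulus (-b) ≤ modulus b := fun b =>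
    modulus_le fun θ => by
      refine le_trans (le_of_eq ?_) ((neg_le_abs _).trans (abs_le_modulus b θ))
      simp only [neg_re, neg_im]
      module
  refine le_antisymm (key a) ?_
  simpa using key (-a)

theorem modulus_sub_comm (a b : Complexification E) : modulus (a - b) = modulus (b - a) := by
  rw [← modulus_neg, neg_sub]

theorem modulus_sub_le (a b c : Complexification E) :
    modulus (a - c) ≤ modulus (a - b) + modulus (b - c) := by
  rw [← sub_add_sub_cancel a b c]
  exact modulus_add_le _ _

theorem eq_zero_of_modulus_nonpos {a : Complexification E} (h : modulus a ≤ 0) : a = 0 := by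
  ext
  · exact eq_zero_of_abs_nonpos ((abs_re_le_modulus a).trans h)
  · exact eq_zero_of_abs_nonpos ((abs_im_le_modulus a).trans h)

end Ring

section CommRing

open IsPhiAlgebra

variable {E : Type*} [ConditionallyCompleteLattice E] [CommRing E] [Algebra ℝ E]
  [IsOrderedAddMonoid E] [IsOrderedModule ℝ E] [IsPhiAlgebra E]

theorem mul_self_add_mul_self_rotate (f g : E) (θ : ℝ) :
    (Real.cos θ • f + Real.sin θ • g) * (Real.cos θ • f + Real.sin θ • g) +
      (Real.cos (θ + Real.pi / 2) • f + Real.sin (θ + Real.pi / 2) • g) *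
        (Real.cos (θ + Real.pi / 2) • f + Real.sin (θ + Real.pi / 2) • g) =
      f * f + g * g := by
  have h : algebraMap ℝ E (Real.sin θ) ^ 2 + algebraMap ℝ E (Real.cos θ) ^ 2 = 1 := by
    rw [← map_pow, ← map_pow, ← map_add, Real.sin_sq_add_cos_sq, map_one]
  rw [Real.cos_add_pi_div_two, Real.sin_add_pi_div_two]
  simp only [Algebra.smul_def, map_neg]
  linear_combination (f * f + g * g) * h

theorem mul_self_rotate_le (f g : E) (θ : ℝ) :
    (Real.cos θ • f + Real.sin θ • g) * (Real.cos θ • f + Real.sin θ • g) ≤ f * f + g * g := by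
  rw [← mul_self_add_mul_self_rotate f g θ, ← sub_nonneg, add_sub_cancel_left]
  exact mul_self_nonneg _

theorem modulus_mul_self_le (a : Complexification E) :
    modulus a * modulus a ≤ a.re * a.re + a.im * a.im := by
  set S := a.re * a.re + a.im * a.im
  set x : ℝ → E := fun θ => Real.cos θ • a.re + Real.sin θ • a.im
  -- Positive parts do not change the supremum, since the modulus is positive, and they make order
  -- continuity of multiplication applicable in each factor.
  have hLUB : IsLUB (Set.range fun θ => (x θ)⁺) (modulus a) := by
    refine ⟨?_, fun z hz => modulus_le fun θ => (le_posPart _).trans (hz ⟨θ, rfl⟩)⟩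
    rintro _ ⟨θ, rfl⟩
    exact sup_le (le_modulus a θ) (modulus_nonneg a)
  have hnn : ∀ y ∈ Set.range fun θ => (x θ)⁺, 0 ≤ y := by
    rintro _ ⟨θ, rfl⟩; exact posPart_nonneg _
  have hle : ∀ θ, (x θ)⁺ * (x θ)⁺ ≤ S := fun θ =>
    (posPart_mul_posPart_le _).trans (mul_self_rotate_le _ _ θ)
  refine mul_le_of_isLUB hLUB hnn (modulus_nonneg a) ?_
  rintro _ ⟨θ, rfl⟩
  rw [mul_comm]
  refine mul_le_of_isLUB hLUB hnn (posPart_nonneg _) ?_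
  rintro _ ⟨φ, rfl⟩
  rw [← sub_nonneg]
  refine nonneg_of_nsmul_nonneg (n := 2) two_pos ?_
  -- The arithmetic-geometric mean inequality: 2(x θ)⁺(x φ)⁺ is at most the sum of the two squares,
  -- hence at most 2S.
  have h1 := add_nonneg (add_nonneg (sub_nonneg.2 (hle θ)) (sub_nonneg.2 (hle φ)))
    (mul_self_nonneg ((x θ)⁺ - (x φ)⁺))
  convert h1 using 1
  rw [two_nsmul]
  ring

theorem le_modulus_mul_self (a : Complexification E) :
    a.re * a.re + a.im * a.im ≤ modulus a * modulus a := by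
  set m := modulus a with hm
  have hm0 : 0 ≤ m := modulus_nonneg a
  set x : ℝ → E := fun θ => Real.cos θ • a.re + Real.sin θ • a.im with hx
  have hxm : ∀ θ, |x θ| ≤ m := abs_le_modulus a
  -- By rotation invariance f² + g² = (x θ)² + (x (θ - π/2))², and the second square is at most m².
  have hlow : ∀ θ, a.re * a.re + a.im * a.im - m * m ≤ |x θ * m| := by
    intro θ
    have h1 := mul_self_add_mul_self_rotate a.re a.im (θ - Real.pi / 2)
    rw [sub_add_cancel] at h1
    have h2 : x (θ - Real.pi / 2) * x (θ - Real.pi / 2) ≤ m * m := by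
      rw [← IsPhiAlgebra.abs_mul_abs_self]
      exact (mul_le_mul_right_of_nonneg (hxm _) (abs_nonneg _)).trans
        (mul_le_mul_left_of_nonneg (hxm _) hm0)
    have h3 : x θ * x θ ≤ |x θ * m| := by
      rw [← IsPhiAlgebra.abs_mul_abs_self, abs_mul_of_nonneg_right _ hm0]
      exact mul_le_mul_left_of_nonneg (hxm _) (abs_nonneg _)
    rw [← h1, sub_le_iff_le_add, add_comm]
    exact add_le_add h3 h2
  have hstep : ∀ θ φ d : ℝ, |θ - φ| ≤ d → |x θ - x φ| ≤ (2 * d) • m := by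
    intro θ φ d h
    have hd : 0 ≤ d := (abs_nonneg _).trans h
    have h1 : x θ - x φ = (Real.cos θ - Real.cos φ) • a.re + (Real.sin θ - Real.sin φ) • a.im := by
      simp only [hx]; module
    rw [h1, two_mul, add_smul]
    refine (abs_add_le _ _).trans (add_le_add ?_ ?_)
    · exact (abs_smul_le ((Real.abs_cos_sub_cos_le θ φ).trans h) _).trans
        (smul_le_smul_of_nonneg_left (abs_re_le_modulus a) hd)
    · exact (abs_smul_le ((Real.abs_sin_sub_sin_le θ φ).trans h) _).trans
        (smul_le_smul_of_nonneg_left (abs_im_le_modulus a) hd)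
  rw [← sub_nonpos]
  refine vectorLattice_archimedean _ ((2 * Real.pi) • (m * m)) fun n => ?_
  rcases Nat.eq_zero_or_pos n with rfl | hn
  · rw [zero_smul]
    exact smul_nonneg (by positivity) (mul_self_nonneg m)
  have hn' : (0 : ℝ) < n := by exact_mod_cast hn
  -- Half a turn in n equal steps takes x to -x, so the intermediate value bound makes the defect f²
  -- + g² - m² at most (2π/n) m².
  have h1 := le_of_abs_sub_le_of_eq_neg (n := n) (y := fun j : ℕ => x (j * (Real.pi / n)) * m)
    (t := a.re * a.re + a.im * a.im - m * m) (d := (2 * (Real.pi / n)) • (m * m))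
    (fun j => hlow _) (fun j => by
      rw [← sub_mul, abs_mul_of_nonneg_right _ hm0, ← smul_mul_assoc]
      refine mul_le_mul_right_of_nonneg (hstep _ _ _ (le_of_eq ?_)) hm0
      rw [← sub_mul]
      push_cast
      rw [add_sub_cancel_left, one_mul, abs_of_nonneg (by positivity)])
    (by
      simp only [hx]
      rw [mul_div_cancel₀ _ hn'.ne']
      simp)
  have h2 := nsmul_le_nsmul_right h1 n
  refine h2.trans (le_of_eq ?_)
  rw [← Nat.cast_smul_eq_nsmul ℝ, smul_smul]
  congr 1
  field_simp

theorem modulus_mul_self (a : Complexification E) :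
    modulus a * modulus a = a.re * a.re + a.im * a.im :=
  le_antisymm (modulus_mul_self_le a) (le_modulus_mul_self a)

end CommRing

end Complexification

/-! ### Uniqueness of positive square roots and multiplicativity of the modulus -/

namespace IsPhiAlgebra

variable {E : Type*} [ConditionallyCompleteLattice E] [CommRing E] [Algebra ℝ E]
  [IsOrderedAddMonoid E] [IsOrderedModule ℝ E] [IsPhiAlgebra E]

theorem eq_zero_of_mul_self_eq_zero {x : E} (h : x * x = 0) : x = 0 := by
  have key : ∀ y : E, y * y = 0 → y ≤ 0 := by
    intro y hy
    refine vectorLattice_archimedean _ 1 fun n => ?_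
    rw [← sub_nonneg]
    refine nonneg_of_nsmul_nonneg (n := 2) two_pos ?_
    -- Since y² = 0, (1 - ny)² = 1 - 2ny, and its positivity bounds ny by 1 for every n.
    have h1 := add_nonneg (mul_self_nonneg (1 - n * y)) (one_nonneg E)
    have h2 : 2 • (1 - n • y) = (1 - n * y) * (1 - n * y) + 1 := by
      simp only [nsmul_eq_mul]
      linear_combination (-(n : E) * n) * hy
    rwa [h2]
  refine le_antisymm (key x h) (neg_nonpos.1 (key (-x) ?_))
  rw [neg_mul_neg, h]

/-- Since |x - y| ≤ x + y, the square of x - y is at most |x - y|(x + y) = |x² - y²| = 0. -/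
theorem eq_of_mul_self_eq {x y : E} (hx : 0 ≤ x) (hy : 0 ≤ y) (h : x * x = y * y) : x = y := by
  have h1 : |x - y| * (x + y) = 0 := by
    rw [← abs_mul_of_nonneg_right _ (add_nonneg hx hy),
      show (x - y) * (x + y) = x * x - y * y by ring, h, sub_self, abs_zero]
  have h2 : |x - y| ≤ x + y := by
    rw [sub_eq_add_neg]
    refine (abs_add_le _ _).trans (le_of_eq ?_)
    rw [abs_neg, abs_of_nonneg hx, abs_of_nonneg hy]
  have h3 := mul_le_mul_left_of_nonneg h2 (abs_nonneg (x - y))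
  rw [h1, IsPhiAlgebra.abs_mul_abs_self] at h3
  exact sub_eq_zero.1 (eq_zero_of_mul_self_eq_zero (le_antisymm h3 (mul_self_nonneg _)))

end IsPhiAlgebra

namespace Complexification

variable {E : Type*} [ConditionallyCompleteLattice E] [CommRing E] [Algebra ℝ E]
  [IsOrderedAddMonoid E] [IsOrderedModule ℝ E] [IsPhiAlgebra E]

open IsPhiAlgebra

theorem modulus_mul (a b : Complexification E) : modulus (a * b) = modulus a * modulus b := by
  refine eq_of_mul_self_eq (modulus_nonneg _)
    (mul_nonneg _ _ (modulus_nonneg _) (modulus_nonneg _)) ?_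
  rw [mul_mul_mul_comm, modulus_mul_self, modulus_mul_self, modulus_mul_self, mul_re, mul_im]
  ring

theorem modulus_one : modulus (1 : Complexification E) = 1 :=
  (modulus_ofReal (1 : E)).trans (abs_of_nonneg (one_nonneg E))

theorem modulus_pow (a : Complexification E) (n : ℕ) : modulus (a ^ n) = modulus a ^ n := by
  induction n with
  | zero => rw [pow_zero, pow_zero, modulus_one]
  | succ n ih => rw [pow_succ, pow_succ, modulus_mul, ih]

end Complexification
-- Components of the unit and bounds from lateral completeness
namespace IsPhiAlgebra

section UnitComponent

variable {E : Type*} [ConditionallyCompleteLattice E] [CommRing E] [Algebra ℝ E]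
  [IsOrderedAddMonoid E] [IsOrderedModule ℝ E] [IsPhiAlgebra E]

theorem nsmul_inf_nsmul_eq_zero {x y : E} (h : x ⊓ y = 0) (m n : ℕ) :
    (m • x) ⊓ (n • y) = 0 := by
  have h1 := mul_left_inf x y m h (natCast_nonneg m)
  rw [inf_comm] at h1 ⊢
  simpa only [nsmul_eq_mul] using mul_left_inf y _ n h1 (natCast_nonneg n)

theorem inf_eq_zero_of_le {x y x' y' : E} (h : x ⊓ y = 0) (hx : 0 ≤ x') (hxx : x' ≤ x)
    (hy : 0 ≤ y') (hyy : y' ≤ y) : x' ⊓ y' = 0 :=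
  le_antisymm (h ▸ inf_le_inf hxx hyy) (le_inf hx hy)

/-- The component of `1` in the band generated by `v`. -/
noncomputable def unitComponent (v : E) : E := ⨆ n : ℕ, (n • v) ⊓ 1

theorem isLUB_unitComponent (v : E) :
    IsLUB (Set.range fun n : ℕ => (n • v) ⊓ 1) (unitComponent v) :=
  isLUB_ciSup ⟨1, by rintro _ ⟨n, rfl⟩; exact inf_le_right⟩

theorem le_unitComponent (v : E) (n : ℕ) : (n • v) ⊓ 1 ≤ unitComponent v :=
  (isLUB_unitComponent v).1 ⟨n, rfl⟩

theorem unitComponent_le_one (v : E) : unitComponent v ≤ 1 :=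
  (isLUB_unitComponent v).2 (by rintro _ ⟨n, rfl⟩; exact inf_le_right)

theorem unitComponent_nonneg (v : E) : 0 ≤ unitComponent v := by
  have := le_unitComponent v 0
  rwa [zero_smul, inf_eq_left.2 (one_nonneg E)] at this

theorem unitComponent_mono {v w : E} (h : v ≤ w) : unitComponent v ≤ unitComponent w := by
  refine (isLUB_unitComponent v).2 ?_
  rintro _ ⟨n, rfl⟩
  exact (inf_le_inf_right _ (nsmul_le_nsmul_right h n)).trans (le_unitComponent w n)

theorem unitComponent_zero : unitComponent (0 : E) = 0 := by
  refine le_antisymm ((isLUB_unitComponent _).2 ?_) (unitComponent_nonneg _)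
  rintro _ ⟨n, rfl⟩
  simp

theorem inf_unitComponent_eq_zero {y v : E} (h : y ⊓ v = 0) : y ⊓ unitComponent v = 0 := by
  have hy : 0 ≤ y := h ▸ inf_le_left
  refine le_antisymm ?_ (le_inf hy (unitComponent_nonneg v))
  refine le_of_isLUB_of_forall_le_nsmul_sub (isLUB_unitComponent v) one_pos ?_
  rintro _ ⟨n, rfl⟩
  rw [one_smul]
  have h1 := inf_add_le_inf_add (x := y) (y := (n • v) ⊓ 1)
    (sub_nonneg.2 (le_unitComponent v n))
  rw [add_sub_cancel] at h1
  refine h1.trans (le_of_le_of_eq (add_le_add_left ?_ _) (zero_add _))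
  have h2 := nsmul_inf_nsmul_eq_zero h 1 n
  rw [one_smul] at h2
  exact (inf_le_inf_left _ inf_le_left).trans h2.le

/-- The reason is that 1 ∧ 2Q ≤ P for each approximant Q = nv ∧ 1 of P, as 2Q ≤ (2n)v. Replacing Q
by P costs 2(P - Q), which the supremum absorbs. -/
theorem unitComponent_inf_one_sub (v : E) :
    unitComponent v ⊓ (1 - unitComponent v) = 0 := by
  set P := unitComponent v with hP
  refine le_antisymm ?_ (le_inf (unitComponent_nonneg v) (sub_nonneg.2 (unitComponent_le_one v)))
  refine le_of_isLUB_of_forall_le_nsmul_sub (isLUB_unitComponent v) two_pos ?_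
  rintro _ ⟨n, rfl⟩
  rw [← hP]
  set Q := (n • v) ⊓ 1 with hQ
  have hQP : Q ≤ P := le_unitComponent v n
  have h1 : P ⊓ (1 - P) + P ≤ 1 ⊓ (2 • Q + 2 • (P - Q)) := by
    refine le_inf (le_sub_iff_add_le.1 inf_le_right) ?_
    rw [← nsmul_add, add_sub_cancel, two_nsmul]
    exact add_le_add_left inf_le_left _
  have h2 : 1 ⊓ 2 • Q ≤ P := by
    refine le_trans ?_ (le_unitComponent v (2 * n))
    rw [inf_comm]
    refine inf_le_inf_right _ ?_
    rw [mul_nsmul']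
    exact nsmul_le_nsmul_right inf_le_left 2
  have h3 := h1.trans ((inf_add_le_inf_add (nsmul_nonneg (sub_nonneg.2 hQP) 2)).trans
    (add_le_add_left h2 _))
  rwa [add_comm, add_le_add_iff_left] at h3

/-- The bands on which `d` is bounded away from zero exhaust the algebra if `d` is a weak order
unit. -/
theorem isLUB_unitComponent_nsmul_sub_one {d : E} (hd : IsWeakOrderUnit d) :
    IsLUB (Set.range fun k : ℕ => unitComponent (k • d - 1)⁺) 1 := by
  refine ⟨by rintro _ ⟨k, rfl⟩; exact unitComponent_le_one _, fun z hz => ?_⟩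
  have hw : (1 - z)⁺ = 0 := by
    set w := (1 - z)⁺ with hw
    have hw0 : 0 ≤ w := posPart_nonneg _
    -- What lies beyond an upper bound z of the components is disjoint from every (kd - 1)⁺, so k(d
    -- ∧ w) ≤ 1 for all k.
    have h1 : ∀ k : ℕ, w ⊓ (k • d - 1)⁺ = 0 := by
      intro k
      have h2 : w ≤ 1 - unitComponent (k • d - 1)⁺ :=
        sup_le (sub_le_sub_left (hz ⟨k, rfl⟩) _) (sub_nonneg.2 (unitComponent_le_one _))
      refine le_antisymm ?_ (le_inf hw0 (posPart_nonneg _))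
      rw [← unitComponent_inf_one_sub (k • d - 1)⁺]
      refine le_inf (le_trans (le_inf ?_ ?_) (le_unitComponent _ 1)) (inf_le_left.trans h2)
      · rw [one_smul]
        exact inf_le_right
      · exact (inf_le_left.trans h2).trans (sub_le_self _ (unitComponent_nonneg _))
    refine hd.2 w (le_antisymm ?_ (le_inf hd.1 (abs_nonneg _)))
    rw [abs_of_nonneg hw0]
    refine vectorLattice_archimedean _ 1 fun k => ?_
    have h3 : k • d ≤ (k • d - 1)⁺ + 1 := sub_le_iff_le_add.1 (le_posPart _)
    have h4 : k • (d ⊓ w) ≤ (k • w) ⊓ ((k • d - 1)⁺ + 1) :=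
      le_inf (nsmul_le_nsmul_right inf_le_right k)
        ((nsmul_le_nsmul_right inf_le_left k).trans h3)
    refine h4.trans ((inf_add_le_inf_add (one_nonneg E)).trans (le_of_eq ?_))
    have h5 := nsmul_inf_nsmul_eq_zero (h1 k) k 1
    rw [one_smul] at h5
    rw [h5, zero_add]
  exact sub_nonpos.1 (posPart_eq_zero.1 hw)

/-- In a universally complete `Φ`-algebra, the candidates for the inverse of a weak order unit
are bounded. -/
theorem bddAbove_of_mul_le_one [IsUniversallyComplete E] {d : E} (hd : IsWeakOrderUnit d) :
    BddAbove {s : E | 0 ≤ s ∧ s * d ≤ 1} := by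
  set q : ℕ → E := fun k => unitComponent (k • d - 1)⁺ with hq
  have hq_mono : Monotone q := fun i j hij => unitComponent_mono
    (posPart_mono (sub_le_sub_right (nsmul_le_nsmul_left hd.1 hij) _))
  have hq0 : q 0 = 0 := by
    simp only [hq, zero_smul, zero_sub, posPart_neg, negPart_eq_zero.2 (one_nonneg E)]
    exact unitComponent_zero
  set c : ℕ → E := fun k => q (k + 1) - q k with hc
  have hc0 : ∀ k, 0 ≤ c k := fun k => sub_nonneg.2 (hq_mono k.le_succ)
  have hqc : ∀ i k, i ≤ k → q i ⊓ c k = 0 := fun i k hik =>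
    inf_eq_zero_of_le (unitComponent_inf_one_sub (k • d - 1)⁺)
      (unitComponent_nonneg _) (hq_mono hik) (hc0 k) (sub_le_sub_right (unitComponent_le_one _) _)
  have hcc : ∀ i k, i < k → c i ⊓ c k = 0 := fun i k hik =>
    inf_eq_zero_of_le (hqc (i + 1) k hik) (hc0 i) (sub_le_self _ (unitComponent_nonneg _))
      (hc0 k) le_rfl
  -- On the component c k one has (k + 1)d ≥ 1, so s * d ≤ 1 forces s ≤ k + 1 there; u glues these
  -- local bounds.
  obtain ⟨u, hu⟩ := IsLaterallyComplete.exists_isLUB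
    (Set.range fun k : ℕ => (k + 1) • c k) (Set.range_nonempty _)
    (by rintro _ ⟨k, rfl⟩; exact nsmul_nonneg (hc0 k) _)
    (by
      rintro _ ⟨i, rfl⟩ _ ⟨k, rfl⟩ hne
      rcases lt_trichotomy i k with h | rfl | h
      · exact nsmul_inf_nsmul_eq_zero (hcc i k h) _ _
      · exact absurd rfl hne
      · simp only
        rw [inf_comm]
        exact nsmul_inf_nsmul_eq_zero (hcc k i h) _ _)
  refine ⟨u, ?_⟩
  rintro s ⟨hs0, hs⟩
  have hsc : ∀ k, s * c k ≤ u := by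
    intro k
    refine le_trans ?_ (hu.1 ⟨k, rfl⟩)
    have h1 : ((k + 1) • d - 1)⁻ * c k = 0 := by
      refine mul_eq_zero_of_inf_eq_zero (inf_eq_zero_of_le
        (inf_unitComponent_eq_zero (v := ((k + 1) • d - 1)⁺) ?_) (negPart_nonneg _) le_rfl
        (hc0 k) (sub_le_self _ (unitComponent_nonneg _)))
      rw [inf_comm]
      exact posPart_inf_negPart_eq_zero _
    have h2 : 0 ≤ ((k + 1) • d - 1) * c k := by
      nth_rewrite 1 [← posPart_sub_negPart ((k + 1) • d - 1)]
      rw [sub_mul, h1, sub_zero]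
      -- The negative part of (k + 1)d - 1 vanishes on c k, because c k lies below the component
      -- generated by the positive part.
      exact mul_nonneg _ _ (posPart_nonneg _) (hc0 k)
    have h3 := add_nonneg (mul_nonneg _ _ hs0 h2)
      (mul_nonneg _ _ (nsmul_nonneg (hc0 k) (k + 1)) (sub_nonneg.2 hs))
    rw [← sub_nonneg]
    convert h3 using 1
    simp only [nsmul_eq_mul]
    ring
  have hsq : ∀ k, s * q k ≤ u := by
    intro k
    induction k with
    | zero =>
      rw [hq0, mul_zero]
      exact (nsmul_nonneg (hc0 0) _).trans (hu.1 ⟨0, rfl⟩)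
    | succ k ih =>
      have h1 : (s * q k) ⊓ (s * c k) = 0 := by
        have h2 := mul_left_inf _ _ s (hqc k k le_rfl) hs0
        rw [inf_comm] at h2 ⊢
        exact mul_left_inf _ _ s h2 hs0
      -- The two summands of s * q (k + 1) are disjoint, so their sum is their join and the bound u
      -- does not grow.
      have h3 : s * q (k + 1) = (s * q k) ⊔ (s * c k) := by
        have h4 := inf_add_sup (s * q k) (s * c k)
        rw [h1, zero_add] at h4
        rw [h4, hc, ← mul_add, add_sub_cancel]
      rw [h3]
      exact sup_le ih (hsc k)
  have := mul_le_of_isLUB (isLUB_unitComponent_nsmul_sub_one hd)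
    (by rintro _ ⟨k, rfl⟩; exact unitComponent_nonneg _) hs0
    (by rintro _ ⟨k, rfl⟩; exact hsq k)
  rwa [mul_one] at this

theorem isWeakOrderUnit_one_sub {r : E} (h : StrictlyBelow r 1) :
    IsWeakOrderUnit (1 - r) := by
  have h1 : (1 - r)⁻ = 0 := h.2 _ (by
    rw [abs_of_nonneg (negPart_nonneg _)]
    exact posPart_inf_negPart_eq_zero _)
  have h2 := posPart_eq_self.2 (negPart_eq_zero.1 h1)
  rw [StrictlyBelow, h2] at h
  exact h

theorem bddAbove_geom_sum [IsUniversallyComplete E] {r : E} (hr : 0 ≤ r)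
    (h : StrictlyBelow r 1) :
    BddAbove (Set.range fun m : ℕ => ∑ n ∈ Finset.range m, r ^ n) := by
  refine (bddAbove_of_mul_le_one (isWeakOrderUnit_one_sub h)).mono ?_
  rintro _ ⟨m, rfl⟩
  refine ⟨Finset.sum_nonneg fun n _ => pow_nonneg hr n, ?_⟩
  simp only
  rw [geom_sum_mul_neg]
  exact sub_le_self _ (pow_nonneg hr m)

end UnitComponent

end IsPhiAlgebra

/-- `p n ↓ 0`. -/
def DecreasesToZero {E : Type*} [Lattice E] [AddCommGroup E] (p : ℕ → E) : Prop :=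
  Antitone p ∧ IsGLB (Set.range p) 0

/-! ### Sequences decreasing to zero -/

namespace DecreasesToZero

section Lattice

variable {E : Type*} [Lattice E] [AddCommGroup E] [IsOrderedAddMonoid E] {p q : ℕ → E}

theorem le_zero (hp : DecreasesToZero p) {z : E} (h : ∀ n, z ≤ p n) : z ≤ 0 :=
  hp.2.2 (by rintro _ ⟨n, rfl⟩; exact h n)

theorem nonneg (hp : DecreasesToZero p) (n : ℕ) : 0 ≤ p n := hp.2.1 ⟨n, rfl⟩

theorem add (hp : DecreasesToZero p) (hq : DecreasesToZero q) :
    DecreasesToZero fun n => p n + q n := by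
  refine ⟨fun i j h => add_le_add (hp.1 h) (hq.1 h), ?_, fun z hz => ?_⟩
  · rintro _ ⟨n, rfl⟩
    exact add_nonneg (hp.nonneg n) (hq.nonneg n)
  · refine hp.le_zero fun m => ?_
    rw [← sub_nonpos]
    refine hq.le_zero fun n => ?_
    rw [sub_le_iff_le_add']
    exact (hz ⟨max m n, rfl⟩).trans
      (add_le_add (hp.1 (le_max_left m n)) (hq.1 (le_max_right m n)))

theorem of_isLUB {S : ℕ → E} {F : E} (hS : Monotone S) (hF : IsLUB (Set.range S) F) :
    DecreasesToZero fun n => F - S n := by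
  refine ⟨fun i j h => sub_le_sub_left (hS h) _, ?_, fun z hz => ?_⟩
  · rintro _ ⟨n, rfl⟩
    exact sub_nonneg.2 (hF.1 ⟨n, rfl⟩)
  · have : F ≤ F - z := hF.2 (by
      rintro _ ⟨n, rfl⟩
      exact le_sub_comm.1 (hz ⟨n, rfl⟩))
    exact (le_sub_self_iff F).1 this

end Lattice

variable {E : Type*} [ConditionallyCompleteLattice E] [CommRing E] [Algebra ℝ E]
  [IsOrderedAddMonoid E] [IsOrderedModule ℝ E] [IsPhiAlgebra E] {p : ℕ → E}

theorem mul_left (hp : DecreasesToZero p) {c : E} (hc : 0 ≤ c) :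
    DecreasesToZero fun n => c * p n := by
  refine ⟨fun i j h => IsPhiAlgebra.mul_le_mul_left_of_nonneg (hp.1 h) hc, ?_, fun z hz => ?_⟩
  · rintro _ ⟨n, rfl⟩
    exact IsPhiAlgebra.mul_nonneg _ _ hc (hp.nonneg n)
  · have hLUB : IsLUB (Set.range fun n => p 0 - p n) (p 0) := by
      refine ⟨?_, fun y hy => ?_⟩
      · rintro _ ⟨n, rfl⟩
        exact sub_le_self _ (hp.nonneg n)
      · rw [← sub_nonpos]
        exact hp.le_zero fun n => sub_le_comm.1 (hy ⟨n, rfl⟩)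
    have := IsPhiAlgebra.mul_le_of_isLUB (z := c * p 0 - z) hLUB
      (by rintro _ ⟨n, rfl⟩; exact sub_nonneg.2 (hp.1 n.zero_le)) hc
      (by
        rintro _ ⟨n, rfl⟩
        rw [mul_sub]
        exact sub_le_sub_left (hz ⟨n, rfl⟩) _)
    exact (le_sub_self_iff _).1 this

end DecreasesToZero

/-- A series whose absolute values have bounded partial sums converges in order. -/
theorem exists_decreasesToZero_abs_sum_sub_le {E : Type*} [ConditionallyCompleteLattice E]
    [AddCommGroup E] [IsOrderedAddMonoid E] {g : ℕ → E}
    (h : BddAbove (Set.range fun m : ℕ => ∑ n ∈ Finset.range (m + 1), |g n|)) :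
    ∃ F : E, ∃ p : ℕ → E, DecreasesToZero p ∧
      ∀ m, |∑ n ∈ Finset.range (m + 1), g n - F| ≤ p m := by
  have key : ∀ b : ℕ → E, (∀ n, 0 ≤ b n) → (∀ n, b n ≤ |g n|) →
      ∃ F, DecreasesToZero fun m => F - ∑ n ∈ Finset.range (m + 1), b n := by
    intro b hb0 hb
    refine ⟨_, DecreasesToZero.of_isLUB ?_ (isLUB_ciSup ?_)⟩
    · refine monotone_nat_of_le_succ fun m => ?_
      rw [Finset.sum_range_succ _ (m + 1)]
      exact le_add_of_nonneg_right (hb0 _)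
    · obtain ⟨B, hB⟩ := h
      refine ⟨B, ?_⟩
      rintro _ ⟨m, rfl⟩
      exact (Finset.sum_le_sum fun n _ => hb n).trans (hB ⟨m, rfl⟩)
  obtain ⟨F, hF⟩ := key (fun n => (g n)⁺) (fun n => posPart_nonneg _)
    (fun n => sup_le (le_abs_self _) (abs_nonneg _))
  obtain ⟨G, hG⟩ := key (fun n => (g n)⁻) (fun n => negPart_nonneg _)
    (fun n => sup_le (neg_le_abs _) (abs_nonneg _))
  refine ⟨F - G, _, hG.add hF, fun m => ?_⟩
  have h1 : ∑ n ∈ Finset.range (m + 1), g n - (F - G) =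
      (G - ∑ n ∈ Finset.range (m + 1), (g n)⁻) - (F - ∑ n ∈ Finset.range (m + 1), (g n)⁺) := by
    have : ∑ n ∈ Finset.range (m + 1), g n =
        ∑ n ∈ Finset.range (m + 1), (g n)⁺ - ∑ n ∈ Finset.range (m + 1), (g n)⁻ := by
      rw [← Finset.sum_sub_distrib]
      exact Finset.sum_congr rfl fun n _ => (posPart_sub_negPart (g n)).symm
    rw [this]
    abel
  rw [h1, sub_eq_add_neg]
  refine (abs_add_le _ _).trans (le_of_eq ?_)
  rw [abs_neg, abs_of_nonneg (hF.nonneg m), abs_of_nonneg (hG.nonneg m)]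

/-! ### Order convergent series and the geometric series -/

namespace Complexification

section Series

variable {E : Type*} [ConditionallyCompleteLattice E] [CommRing E] [Algebra ℝ E]
  [IsOrderedAddMonoid E] [IsOrderedModule ℝ E]

theorem sum_re (x : ℕ → Complexification E) (m : ℕ) :
    (∑ n ∈ Finset.range m, x n).re = ∑ n ∈ Finset.range m, (x n).re := by
  induction m with
  | zero => simp
  | succ m ih => rw [Finset.sum_range_succ, Finset.sum_range_succ, add_re, ih]

theorem sum_im (x : ℕ → Complexification E) (m : ℕ) :
    (∑ n ∈ Finset.range m, x n).im = ∑ n ∈ Finset.range m, (x n).im := by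
  induction m with
  | zero => simp
  | succ m ih => rw [Finset.sum_range_succ, Finset.sum_range_succ, add_im, ih]

theorem exists_hasOrderSum {x : ℕ → Complexification E}
    (h : BddAbove (Set.range fun m : ℕ => ∑ n ∈ Finset.range (m + 1), modulus (x n))) :
    ∃ s, HasOrderSum x s := by
  have key : ∀ g : ℕ → E, (∀ n, |g n| ≤ modulus (x n)) →
      BddAbove (Set.range fun m : ℕ => ∑ n ∈ Finset.range (m + 1), |g n|) := by
    intro g hg
    obtain ⟨B, hB⟩ := h
    refine ⟨B, ?_⟩
    rintro _ ⟨m, rfl⟩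
    exact (Finset.sum_le_sum fun n _ => hg n).trans (hB ⟨m, rfl⟩)
  obtain ⟨F, p, hp, hF⟩ := exists_decreasesToZero_abs_sum_sub_le
    (key (fun n => (x n).re) fun n => abs_re_le_modulus _)
  obtain ⟨G, q, hq, hG⟩ := exists_decreasesToZero_abs_sum_sub_le
    (key (fun n => (x n).im) fun n => abs_im_le_modulus _)
  refine ⟨⟨F, G⟩, _, (hp.add hq).1, (hp.add hq).2, fun m => ?_⟩
  refine (modulus_le_abs_add_abs _).trans (add_le_add ?_ ?_)
  · rw [sub_re, sum_re]
    exact hF m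
  · rw [sub_im, sum_im]
    exact hG m

theorem OrderConvergesTo.unique {x : ℕ → Complexification E} {l l' : Complexification E}
    (h : OrderConvergesTo x l) (h' : OrderConvergesTo x l') : l = l' := by
  obtain ⟨p, hp1, hp2, hp⟩ := h
  obtain ⟨q, hq1, hq2, hq⟩ := h'
  refine sub_eq_zero.1 (eq_zero_of_modulus_nonpos
    (DecreasesToZero.le_zero (DecreasesToZero.add ⟨hp1, hp2⟩ ⟨hq1, hq2⟩) fun n => ?_))
  refine (modulus_sub_le l (x n) l').trans (add_le_add ?_ (hq n))
  rw [modulus_sub_comm]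
  exact hp n

/-- The terms of a convergent series tend to 0: each is a difference of consecutive partial sums, so
2p serves as the bound. -/
theorem HasOrderSum.exists_modulus_succ_le {x : ℕ → Complexification E} {s : Complexification E}
    (h : HasOrderSum x s) : ∃ q : ℕ → E, DecreasesToZero q ∧ ∀ m, modulus (x (m + 1)) ≤ q m := by
  obtain ⟨p, hp1, hp2, hp⟩ := h
  refine ⟨_, DecreasesToZero.add ⟨hp1, hp2⟩ ⟨hp1, hp2⟩, fun m => ?_⟩
  have h1 : x (m + 1) = ∑ n ∈ Finset.range (m + 1 + 1), x n - ∑ n ∈ Finset.range (m + 1), x n := by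
    rw [Finset.sum_range_succ _ (m + 1), add_sub_cancel_left]
  rw [h1]
  refine (modulus_sub_le _ s _).trans (add_le_add ((hp (m + 1)).trans (hp1 m.le_succ)) ?_)
  rw [modulus_sub_comm]
  exact hp m

variable [IsPhiAlgebra E]

open IsPhiAlgebra

theorem mul_comm' (a b : Complexification E) : a * b = b * a := by
  ext <;> simp only [mul_re, mul_im] <;> ring

theorem HasOrderSum.one_sub_mul_eq_one {a s : Complexification E}
    (h : HasOrderSum (fun n : ℕ => a ^ n) s) : (1 - a) * s = 1 := by
  obtain ⟨q, hq, hqa⟩ := h.exists_modulus_succ_le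
  obtain ⟨p, hp1, hp2, hp⟩ := h
  have hlim := (DecreasesToZero.mul_left ⟨hp1, hp2⟩ (modulus_nonneg (1 - a))).add hq
  refine sub_eq_zero.1 (eq_zero_of_modulus_nonpos (hlim.le_zero fun m => ?_))
  have h1 : (1 - a) * s - 1 =
      -((1 - a) * (∑ n ∈ Finset.range (m + 1), a ^ n - s)) + -(a ^ (m + 1)) := by
    rw [mul_sub, mul_neg_geom_sum]
    abel
  rw [h1]
  refine (modulus_add_le _ _).trans (add_le_add ?_ ?_)
  · rw [modulus_neg, modulus_mul]
    exact mul_le_mul_left_of_nonneg (hp m) (modulus_nonneg _)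
  · rw [modulus_neg]
    exact hqa m

theorem strictlyBelow_of_absConvergesInOrder {a : Complexification E}
    (h : AbsConvergesInOrder fun n : ℕ => a ^ n) : StrictlyBelow (modulus a) (1 : E) := by
  obtain ⟨s, hs⟩ := h
  obtain ⟨q, hq, hqa⟩ := hs.exists_modulus_succ_le
  set r := modulus a with hr
  have hr0 : 0 ≤ r := modulus_nonneg a
  refine ⟨posPart_nonneg _, fun x hx => ?_⟩
  -- Truncating at 1 gives z ≤ rᵐ z ≤ rᵐ for all m. Nothing is lost, since |x| ∧ 1 = 0 already
  -- forces x = 0.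
  set z := |x| ⊓ 1 with hz
  have hz0 : 0 ≤ z := le_inf (abs_nonneg x) (one_nonneg E)
  have h1 : (1 - r)⁺ * z = 0 := mul_eq_zero_of_inf_eq_zero
    (inf_eq_zero_of_le hx (posPart_nonneg _) le_rfl hz0 inf_le_left)
  have h2 : z ≤ r * z := by
    have h3 := mul_le_mul_right_of_nonneg (le_posPart (1 - r)) hz0
    rwa [h1, sub_mul, one_mul, sub_nonpos] at h3
  have h4 : ∀ m : ℕ, z ≤ r ^ m * z := by
    intro m
    induction m with
    | zero => rw [pow_zero, one_mul]
    | succ m ih =>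
      rw [pow_succ, mul_assoc]
      exact ih.trans (mul_le_mul_left_of_nonneg h2 (pow_nonneg hr0 m))
  have h5 : z = 0 := by
    refine le_antisymm (hq.le_zero fun m => ?_) hz0
    have h6 := hqa m
    rw [modulus_ofReal, modulus_pow, abs_of_nonneg (pow_nonneg hr0 _)] at h6
    refine (h4 (m + 1)).trans (le_trans ?_ h6)
    have h7 := mul_le_mul_left_of_nonneg (inf_le_right : z ≤ 1) (pow_nonneg hr0 (m + 1))
    rwa [mul_one] at h7
  have h8 := mul_left_inf 1 |x| |x| (by rw [inf_comm]; exact h5) (abs_nonneg x)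
  rw [mul_one, inf_idem] at h8
  exact eq_zero_of_abs_nonpos h8.le

theorem geometric_series [IsUniversallyComplete E] (a : Complexification E) :
    (AbsConvergesInOrder (fun n : ℕ => a ^ n) ↔ StrictlyBelow (modulus a) (1 : E)) ∧
    (StrictlyBelow (modulus a) (1 : E) →
      ∃ u : (Complexification E)ˣ, (u : Complexification E) = 1 - a ∧
        ∀ s : Complexification E, HasOrderSum (fun n : ℕ => a ^ n) s ↔
          s = ((u⁻¹ : (Complexification E)ˣ) : Complexification E)) := by
  have hbdd : StrictlyBelow (modulus a) (1 : E) →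
      BddAbove (Set.range fun m : ℕ => ∑ n ∈ Finset.range (m + 1), modulus (a ^ n)) := by
    intro h
    refine (bddAbove_geom_sum (modulus_nonneg a) h).mono ?_
    rintro _ ⟨m, rfl⟩
    exact ⟨m + 1, Finset.sum_congr rfl fun n _ => (modulus_pow a n).symm⟩
  refine ⟨⟨strictlyBelow_of_absConvergesInOrder, fun h => exists_hasOrderSum ?_⟩, fun h => ?_⟩
  · simpa only [modulus_ofReal, abs_of_nonneg (modulus_nonneg _)] using hbdd h
  · obtain ⟨b, hb⟩ := exists_hasOrderSum (hbdd h)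
    have h1 := hb.one_sub_mul_eq_one
    refine ⟨⟨1 - a, b, h1, by rw [mul_comm', h1]⟩, rfl, fun s => ⟨fun hs => ?_, ?_⟩⟩
    · exact OrderConvergesTo.unique hs hb
    · rintro rfl
      exact hb

end Series

end Complexification
theorem lemma3p4 {E : Type*} [ConditionallyCompleteLattice E] [Ring E] [Algebra ℝ E]
    [IsOrderedAddMonoid E] [IsOrderedModule ℝ E] [IsUniversallyComplete E] [IsPhiAlgebra E]
    (a : Complexification E) :
    (Complexification.AbsConvergesInOrder (fun n : ℕ => a ^ n) ↔
      StrictlyBelow (Complexification.modulus a) (1 : E)) ∧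
    (StrictlyBelow (Complexification.modulus a) (1 : E) →
      ∃ u : (Complexification E)ˣ, (u : Complexification E) = 1 - a ∧
        ∀ s : Complexification E,
          Complexification.HasOrderSum (fun n : ℕ => a ^ n) s ↔
            s = ((u⁻¹ : (Complexification E)ˣ) : Complexification E)) := by
  -- The given ring structure with commutativity added, so the operations on the complexification
  -- are unchanged.
  let : CommRing E := { ‹Ring E› with mul_comm := fun x y => (IsPhiAlgebra.commute x y).eq }
  exact Complexification.geometric_series a
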